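/- Let $Q$ be a prime power. A polynomial over a finite field $\mathbb F$ is said to permute $\mathbb F$ if the map $\mathbb F\to\mathbb F$ it induces is a bijection. For $\alpha\in\mathbb F_{Q^3}^*$, the polynomial $x^{Q^2+Q+2}+\alpha x$ permutes $\mathbb F_{Q^3}$ if and only if at least one of the following occurs: 1. $Q$ is even and $\alpha^{Q^2}+\alpha^Q+\alpha=0$; 2. $Q=7$ and $\alpha^{24}+\alpha^{18}+4\alpha^{12}+2=0$; 3. $Q=3$ and $\alpha^{12}+\alpha^{10}+\alpha^4+1=0$; 4. $Q=2$ and $\alpha\ne 1$. Moreover, if $Q$ satisfies the condition imposed on it in case (1), (2), (3) or (4), then the number of elements $\alpha\in\mathbb F_{Q^3}^*$ having the property stated in that case is $Q^2-1$, $24$, $12$ or $6$, respectively. In addition, for $\alpha\in\mathbb F_{Q^2}^*$, the polynomial $x^{Q+3}+\alpha x^2$ permutes $\mathbb F_{Q^2}$ if and only if $Q=2$ and $\alpha\ne 1$. -/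

import Mathlib

open Polynomial

/-- A polynomial `f` over a field `F` permutes `F` if the map `a ↦ f(a)` is a bijection of `F`. -/
def PermutesField {F : Type*} [Field F] (f : F[X]) : Prop :=
  Function.Bijective (fun a : F => f.eval a)

/-! Write `F` for the subfield of order $Q$, $K$ for its cubic extension, and $N$ for the norm. The
polynomial is $f(x) = x(N(x)+\alpha)$, so $N(f(x)) = g(N(x))$ with $g(t) = t\,N(t+\alpha)$. Since
the norm is surjective, $f$ permutes $K$ exactly when $g$ permutes `F`
(`permutesField_iff_injective`). Here $g(t) = t^4+at^3+bt^2+ct$, where $a,b,c$ are the elementary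
symmetric functions of the conjugates of $\alpha$.

It remains to know which quartics permute `F`. For odd order only 3 and 7 are possible
(`card_eq_three_or_seven_of_injective_quartic`): Hermite's criterion handles everything except
characteristic 3, where a sums-of-squares argument works. Orders 3 and 7 are enumerated, and the
conditions on $a,b,c$ are rewritten in $\alpha$. For even order, $a \ne 0$ forces order 2 by a trace
sum (`card_eq_two_of_injective_quartic_of_charP_two`), while for $a = 0$ the quartic is additive and
has no nonzero root.

The counts hold because each polynomial in $\alpha$ divides $X^{|K|}-X$, so it has as many roots as
its degree. The second family is $x^2(N(x)+\alpha)$ over the quadratic extension. For odd $Q$ it is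
an even function; for even $Q$ the same descent gives a quartic with $c=0$. -/

/-! ### Power sums over a finite field and Hermite's criterion. -/

theorem Fintype.sum_eq_zero_add_sum_units {F M : Type*} [GroupWithZero F] [Fintype F]
    [DecidableEq F] [AddCommMonoid M] (g : F → M) : ∑ x, g x = g 0 + ∑ u : Fˣ, g u := by
  rw [Fintype.sum_eq_add_sum_subtype_ne g 0]
  congr 1
  exact (Fintype.sum_equiv unitsEquivNeZero _ _ fun _ => rfl).symm

theorem FiniteField.sum_pow_eq_ite {F : Type*} [Field F] [Fintype F] {i : ℕ}
    (hi : i < 2 * (Fintype.card F - 1)) :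
    ∑ x : F, x ^ i = if i = Fintype.card F - 1 then -1 else 0 := by
  classical
  have hq : 1 < Fintype.card F := Fintype.one_lt_card
  by_cases h0 : i < Fintype.card F - 1
  · rw [if_neg h0.ne, FiniteField.sum_pow_lt_card_sub_one F i h0]
  have hi0 : i ≠ 0 := by omega
  have hdvd : (Fintype.card F - 1 ∣ i) ↔ i = Fintype.card F - 1 := by
    constructor
    · rintro ⟨k, hk⟩
      have hk2 : k < 2 := by
        by_contra! h
        have := Nat.mul_le_mul_left (Fintype.card F - 1) h
        omega
      interval_cases k <;> omega
    · intro h; rw [h]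
  rw [Fintype.sum_eq_zero_add_sum_units, FiniteField.sum_pow_units, zero_pow hi0, zero_add]
  simp only [hdvd]

theorem FiniteField.sum_eval_eq_neg_coeff {F : Type*} [Field F] [Fintype F] {P : F[X]}
    (hP : P.natDegree < 2 * (Fintype.card F - 1)) :
    ∑ x : F, P.eval x = -P.coeff (Fintype.card F - 1) := by
  simp_rw [eval_eq_sum_range' hP]
  rw [Finset.sum_comm]
  simp_rw [← Finset.mul_sum]
  have hq : 1 < Fintype.card F := Fintype.one_lt_card
  rw [Finset.sum_congr rfl fun i hi => by
    rw [FiniteField.sum_pow_eq_ite (Finset.mem_range.1 hi)]]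
  simp
  omega

/-- The necessity part of Hermite's criterion. -/
theorem FiniteField.coeff_pow_eq_zero_of_injective {F : Type*} [Field F] [Fintype F] {P : F[X]}
    (hP : Function.Injective fun x => P.eval x) {m : ℕ} (hm : m < Fintype.card F - 1)
    (hd : m * P.natDegree < 2 * (Fintype.card F - 1)) :
    (P ^ m).coeff (Fintype.card F - 1) = 0 := by
  have h1 := FiniteField.sum_eval_eq_neg_coeff (P := P ^ m)
    ((natDegree_pow P m).trans_lt hd)
  have h2 : ∑ x : F, (P ^ m).eval x = ∑ x : F, x ^ m := by
    simp_rw [eval_pow]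
    exact (Finite.injective_iff_bijective.1 hP).sum_comp (fun x : F => x ^ m)
  rw [h2, FiniteField.sum_pow_lt_card_sub_one F m hm] at h1
  exact neg_eq_zero.1 h1.symm

/-! ### Permutation quartics over fields of odd order. -/

/-- The power $(q-1)/4$ of the monic quartic has degree exactly $q-1$, so the coefficient that
Hermite's criterion kills is 1. -/
theorem not_injective_quartic_of_card_mod_four_eq_one {F : Type*} [Field F] [Fintype F]
    (hq : Fintype.card F % 4 = 1) (a b c : F) :
    ¬ Function.Injective fun t : F => t ^ 4 + a * t ^ 3 + b * t ^ 2 + c * t := by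
  intro h
  have hq1 : 1 < Fintype.card F := Fintype.one_lt_card
  set P : F[X] := X ^ 4 + C a * X ^ 3 + C b * X ^ 2 + C c * X with hP
  have hd : P.natDegree = 4 := by rw [hP]; compute_degree!
  have hmon : P.Monic := by
    rw [Monic, leadingCoeff, hd, hP]
    simp [coeff_X_pow]
  have h1 := FiniteField.coeff_pow_eq_zero_of_injective (P := P) (m := (Fintype.card F - 1) / 4)
    (by simpa [hP] using h) (by omega) (by rw [hd]; omega)
  have h2 : Fintype.card F - 1 = (P ^ ((Fintype.card F - 1) / 4)).natDegree := by
    rw [hmon.natDegree_pow, hd]; omega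
  rw [h2, ← h2] at h1
  have h3 := (hmon.pow ((Fintype.card F - 1) / 4)).coeff_natDegree
  rw [← h2, h1] at h3
  exact zero_ne_one h3

theorem exists_pow_depressed_quartic_eq {R : Type*} [CommRing R] (b c : R) (m : ℕ) :
    ∃ r : R[X], r.natDegree ≤ 4 * m + 1 ∧ (X ^ 4 + C b * X ^ 2 + C c * X : R[X]) ^ (m + 1) =
      X ^ (4 * m + 4) + C ((m + 1 : ℕ) * b) * X ^ (4 * m + 2) + r := by
  induction m with
  | zero => exact ⟨C c * X, by compute_degree!, by simp⟩
  | succ m ih =>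
    obtain ⟨r, hr, h⟩ := ih
    refine ⟨C c * X ^ (4 * m + 5) + C ((m + 1 : ℕ) * b * b) * X ^ (4 * m + 4) +
      C ((m + 1 : ℕ) * b * c) * X ^ (4 * m + 3) + r * (X ^ 4 + C b * X ^ 2 + C c * X), ?_, ?_⟩
    · have : (r * (X ^ 4 + C b * X ^ 2 + C c * X)).natDegree ≤ 4 * m + 5 := by
        refine natDegree_mul_le.trans ?_
        have : (X ^ 4 + C b * X ^ 2 + C c * X : R[X]).natDegree ≤ 4 := by compute_degree!
        omega
      refine natDegree_add_le_of_degree_le ?_ this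
      compute_degree
      omega
    · rw [pow_succ, h]
      simp only [map_mul, Nat.cast_succ, map_add, map_natCast, map_one]
      ring

/-- With $q = 4m+3$, Hermite's criterion for the power $m+1$ gives $(m+1)b = 0$, and $4(m+1) = q+1 =
1$ in `F`. -/
theorem eq_zero_of_injective_depressed_quartic {F : Type*} [Field F] [Fintype F]
    (hq : Fintype.card F % 4 = 3) (hq3 : 3 < Fintype.card F) {b c : F}
    (h : Function.Injective fun t : F => t ^ 4 + b * t ^ 2 + c * t) : b = 0 := by
  obtain ⟨m, hm⟩ : ∃ m, Fintype.card F = 4 * m + 3 := ⟨Fintype.card F / 4, by omega⟩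
  have hd : (X ^ 4 + C b * X ^ 2 + C c * X : F[X]).natDegree = 4 := by compute_degree!
  have h1 := FiniteField.coeff_pow_eq_zero_of_injective (P := X ^ 4 + C b * X ^ 2 + C c * X)
    (m := m + 1) (by simpa using h) (by omega) (by rw [hd]; omega)
  obtain ⟨r, hr, h2⟩ := exists_pow_depressed_quartic_eq b c m
  rw [h2, hm, show 4 * m + 3 - 1 = 4 * m + 2 by omega, coeff_add, coeff_add, coeff_C_mul,
    coeff_X_pow, coeff_X_pow, coeff_eq_zero_of_natDegree_lt (p := r) (by omega)] at h1
  simp at h1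
  rcases h1 with h1 | h1
  · have h4 : (Fintype.card F : F) = 0 := FiniteField.cast_card_eq_zero F
    rw [hm] at h4
    push_cast at h4
    exact absurd (by linear_combination 4 * h1 - h4 : (1 : F) = 0) one_ne_zero
  · exact h1

/-- If $q \equiv 2 \pmod 3$, cubing is bijective and $t^3 = -c$ gives a nonzero root. Otherwise $q =
12j+7$, and Hermite's criterion for the power $3j+3$ gives $\binom{3j+3}{2}c^2 = 0$. As $4(3j+3) =
5$ and $4(3j+2) = 1$ in `F`, the characteristic is 5, so $q \equiv 1 \pmod 4$. The degree bound in
the criterion needs $j > 0$, that is $q > 7$. -/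
theorem not_injective_pow_four_add_mul {F : Type*} [Field F] [Fintype F]
    (hq : Fintype.card F % 4 = 3) (hq7 : 7 < Fintype.card F) (h3 : (3 : F) ≠ 0) (c : F) :
    ¬ Function.Injective fun t : F => t ^ 4 + c * t := by
  intro h
  have h4 : (Fintype.card F : F) = 0 := FiniteField.cast_card_eq_zero F
  have h2 : (2 : F) ≠ 0 := by
    intro h2
    obtain ⟨m, hm⟩ : ∃ m, Fintype.card F = 4 * m + 3 := ⟨Fintype.card F / 4, by omega⟩
    rw [hm] at h4
    push_cast at h4
    exact one_ne_zero (by linear_combination h4 - (2 * m + 1) * h2 : (1 : F) = 0)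
  have hc : c ≠ 0 := by
    rintro rfl
    have := @h 1 (-1) (by norm_num)
    exact h2 (by linear_combination this)
  have hmod : Fintype.card F % 12 = 7 := by
    by_contra hne
    rcases (by omega : Fintype.card F % 3 = 0 ∨ Fintype.card F % 3 = 2) with h0 | h0
    · obtain ⟨m, hm⟩ : ∃ m, Fintype.card F = 3 * m := ⟨Fintype.card F / 3, by omega⟩
      rw [hm] at h4
      obtain ⟨p, hp⟩ := CharP.exists F
      obtain ⟨n, hpp, hn⟩ := FiniteField.card F p
      have : 3 ∣ p ^ (n : ℕ) := ⟨m, by omega⟩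
      have := (Nat.prime_dvd_prime_iff_eq Nat.prime_three hpp).1 (Nat.prime_three.dvd_of_dvd_pow this)
      subst this
      exact h3 (by exact_mod_cast CharP.cast_eq_zero F 3)
    · obtain ⟨m, hm⟩ : ∃ m, Fintype.card F = 3 * m + 2 := ⟨Fintype.card F / 3, by omega⟩
      have hr : ((-c) ^ (2 * m + 1)) ^ 3 = -c := by
        rw [← pow_mul, show (2 * m + 1) * 3 = (3 * m + 2) + (3 * m + 1) by ring, pow_add, ← hm,
          FiniteField.pow_card, ← pow_succ', show 3 * m + 1 + 1 = Fintype.card F by omega,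
          FiniteField.pow_card]
      have := @h ((-c) ^ (2 * m + 1)) 0 (by
        linear_combination (-c) ^ (2 * m + 1) * hr)
      exact hc (neg_eq_zero.1 (pow_eq_zero_iff (by omega) |>.1 this))
  obtain ⟨j, hj⟩ : ∃ j, Fintype.card F = 12 * j + 7 := ⟨Fintype.card F / 12, by omega⟩
  have hd : (X ^ 4 + C c * X : F[X]).natDegree = 4 := by compute_degree!
  have h1 := FiniteField.coeff_pow_eq_zero_of_injective (P := X ^ 4 + C c * X)
    (m := 3 * j + 3) (by simpa using h) (by omega) (by rw [hd]; omega)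
  have h5 : (X ^ 4 + C c * X : F[X]) ^ (3 * j + 3) =
      expand F 3 ((X + C c) ^ (3 * j + 3)) * X ^ (3 * j + 3) := by
    rw [map_pow, ← mul_pow]
    simp
    ring
  rw [h5, hj, show 12 * j + 7 - 1 = (3 * j + 1) * 3 + (3 * j + 3) by omega, coeff_mul_X_pow,
    coeff_expand_mul (by norm_num), coeff_X_add_C_pow, show 3 * j + 3 - (3 * j + 1) = 2 by omega,
    Nat.choose_symm_of_eq_add (show 3 * j + 3 = (3 * j + 1) + 2 by omega)] at h1
  have h6 : (((3 * j + 3).choose 2 : ℕ) : F) = 0 := by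
    rcases mul_eq_zero.1 h1 with h | h
    · exact absurd (pow_eq_zero_iff (by norm_num) |>.1 h) hc
    · exact h
  have h7 : (3 * j + 3).choose 2 * 2 = (3 * j + 3) * (3 * j + 2) := by
    rw [Nat.choose_two_right]
    exact Nat.div_mul_cancel (Nat.even_mul_pred_self (3 * j + 3)).two_dvd
  have h8 : (((3 * j + 3).choose 2 : ℕ) : F) * 2 = (3 * j + 3) * (3 * j + 2) := by
    exact_mod_cast congrArg (Nat.cast : ℕ → F) h7
  rw [hj] at h4
  push_cast at h4
  have h9 : (5 : F) = 0 := by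
    linear_combination 32 * h6 - 16 * h8 - (12 * j + 13) * h4
  obtain ⟨p, hp⟩ := CharP.exists F
  obtain ⟨n, hpp, hn⟩ := FiniteField.card F p
  have : p ∣ 5 := (CharP.cast_eq_zero_iff F p 5).1 (by exact_mod_cast h9)
  have := (Nat.prime_dvd_prime_iff_eq hpp Nat.prime_five).1 this
  subst this
  have : 5 ^ (n : ℕ) % 4 = 1 := by
    rw [Nat.pow_mod]; simp
  omega

/-- In characteristic 3 the difference quotient $(g(x+d)-g(x))/d$ is the additive polynomial
$x^3+(d^2-b)x$ plus a constant. It has no root, so the additive part is not surjective, hence not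
injective: $b-d^2$ is a nonzero square for every $d \ne 0$. As $-1$ is not a square, this ends in a
contradiction about sums of two squares. -/
theorem not_injective_quartic_of_three_eq_zero {F : Type*} [Field F] [Fintype F]
    (h3 : (3 : F) = 0) (hq : Fintype.card F % 4 = 3) (hq3 : 3 < Fintype.card F) (a b c : F) :
    ¬ Function.Injective fun t : F => t ^ 4 + a * t ^ 3 + b * t ^ 2 + c * t := by
  intro h
  have hneg : ¬ IsSquare (-1 : F) := by
    rw [FiniteField.isSquare_neg_one_iff]
    exact not_not.2 hq
  have hchar : ringChar F ≠ 2 := by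
    intro h
    have := FiniteField.even_card_of_char_two h
    omega
  have hdich : ∀ x : F, x ≠ 0 → ¬ IsSquare x → IsSquare (-x) := by
    intro x hx hns
    have h0 : (-1 : F) ≠ 0 := by simp
    have e1 := (FiniteField.pow_dichotomy hchar hx).resolve_left
      fun h => hns ((FiniteField.isSquare_iff hchar hx).2 h)
    have e2 := (FiniteField.pow_dichotomy hchar h0).resolve_left
      fun h => hneg ((FiniteField.isSquare_iff hchar h0).2 h)
    rw [FiniteField.isSquare_iff hchar (neg_ne_zero.2 hx), ← neg_one_mul, mul_pow, e1, e2]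
    norm_num
  have hexcl : ∀ x : F, x ≠ 0 → IsSquare x → ¬ IsSquare (-x) := by
    rintro x hx ⟨r, hr⟩ ⟨s, hs⟩
    have hr0 : r ≠ 0 := by rintro rfl; simp at hr; exact hx hr
    exact hneg ⟨s / r, by field_simp; linear_combination hs + hr⟩
  have key : ∀ d : F, d ≠ 0 → ∃ e : F, e ≠ 0 ∧ b - d ^ 2 = e ^ 2 := by
    intro d hd
    by_contra! hcon
    have hinj : Function.Injective fun x : F => x ^ 3 + (d ^ 2 - b) * x := by
      intro x y hxy
      by_contra hne
      have hxy0 : x - y ≠ 0 := sub_ne_zero.2 hne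
      refine hcon (x - y) hxy0 (mul_left_cancel₀ hxy0 ?_)
      simp only at hxy
      linear_combination -hxy + x * y * (x - y) * h3
    obtain ⟨x, hx⟩ := Finite.surjective_of_injective hinj (-(d ^ 3 + a * d ^ 2 + b * d + c))
    simp only at hx
    have := @h (x + d) x (by
      simp only
      linear_combination d * hx + (d * x ^ 3 + 2 * d ^ 2 * x ^ 2 + d ^ 3 * x + a * d * x ^ 2
        + a * d ^ 2 * x + b * d * x) * h3)
    exact hd (by linear_combination this)
  have hb : IsSquare (-b) := by
    by_contra hb
    have hb0 : b ≠ 0 := by rintro rfl; simp at hb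
    have : IsSquare b := by
      by_contra hb'
      exact hb (hdich b hb0 hb')
    obtain ⟨r, hr⟩ := this
    obtain ⟨e, he, h⟩ := key r (by rintro rfl; simp at hr; exact hb0 hr)
    rw [hr] at h
    exact he (pow_eq_zero_iff (n := 2) (by norm_num) |>.1 (by linear_combination -h))
  obtain ⟨r, hr⟩ := hb
  have hr0 : r ≠ 0 := by
    rintro rfl
    obtain ⟨e, -, h⟩ := key 1 one_ne_zero
    exact hneg ⟨e, by linear_combination h + hr⟩
  -- Here $-b = r^2$, and $d = yr/x$ makes $b-d^2 = -(r/x)^2(x^2+y^2)$ a nonzero square.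
  have hsum : ∀ x y : F, x ≠ 0 → y ≠ 0 → ¬ IsSquare (x ^ 2 + y ^ 2) := by
    intro x y hx hy
    obtain ⟨e, he, h⟩ := key (y * r / x) (by positivity)
    have h1 : x ^ 2 + y ^ 2 = -(e * x / r) ^ 2 := by
      field_simp at h ⊢
      linear_combination -h - x ^ 2 * hr
    rw [h1]
    exact hexcl _ (by positivity) ⟨e * x / r, by ring⟩
  classical
  obtain ⟨x, hx⟩ : ∃ x : F, x ∉ ({0, 1, -1} : Finset F) := by
    by_contra! hcon
    have := Finset.card_le_card (fun x _ => hcon x : (Finset.univ : Finset F) ⊆ {0, 1, -1})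
    have := this.trans Finset.card_le_three
    rw [Finset.card_univ] at this
    omega
  simp only [Finset.mem_insert, Finset.mem_singleton, not_or] at hx
  obtain ⟨hx0, hx1, hx2⟩ := hx
  have hu : x ^ 2 - 1 ≠ 0 := by
    intro h
    rcases mul_eq_zero.1 (by linear_combination h : (x - 1) * (x + 1) = 0) with h | h
    · exact hx1 (sub_eq_zero.1 h)
    · exact hx2 (eq_neg_of_add_eq_zero_left h)
  -- Either $x^2 = 1+w^2$ or $1 = x^2+w^2$ with $w \ne 0$; both contradict `hsum`.
  by_cases hsq : IsSquare (x ^ 2 - 1)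
  · obtain ⟨w, hw⟩ := hsq
    refine hsum 1 w one_ne_zero (by rintro rfl; simp at hw; exact hu (by linear_combination hw))
      ⟨x, by linear_combination -hw⟩
  · obtain ⟨w, hw⟩ := hdich _ hu hsq
    refine hsum x w hx0 (by rintro rfl; exact hu (by linear_combination -hw))
      ⟨1, by linear_combination -hw⟩

theorem card_eq_three_or_seven_of_injective_quartic {F : Type*} [Field F] [Fintype F]
    (hodd : Odd (Fintype.card F)) {a b c : F}
    (h : Function.Injective fun t : F => t ^ 4 + a * t ^ 3 + b * t ^ 2 + c * t) :
    Fintype.card F = 3 ∨ Fintype.card F = 7 := by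
  have hq1 : 1 < Fintype.card F := Fintype.one_lt_card
  have hq : Fintype.card F % 4 = 3 := by
    have : Fintype.card F % 4 ≠ 1 := fun h1 => not_injective_quartic_of_card_mod_four_eq_one (F := F) h1 a b c h
    have := Nat.odd_iff.1 hodd
    omega
  by_contra! hcon
  by_cases h3 : (3 : F) = 0
  · exact not_injective_quartic_of_three_eq_zero h3 hq (by omega) a b c h
  have h2 : (2 : F) ≠ 0 := by
    intro h2
    have : ringChar F = 2 := CharP.ringChar_of_prime_eq_zero Nat.prime_two (by exact_mod_cast h2)
    have := FiniteField.even_card_of_char_two this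
    omega
  have h4 : (4 : F) ≠ 0 := by
    have : (4 : F) = 2 * 2 := by norm_num
    rw [this]
    exact mul_ne_zero h2 h2
  obtain ⟨e, rfl⟩ : ∃ e, a = 4 * e := ⟨a / 4, by field_simp⟩
  -- The shift $t \mapsto t-e$ with $e = a/4$ removes the cubic term; the constant is dropped.
  have hbc : Function.Injective fun t : F =>
      t ^ 4 + (b - 6 * e ^ 2) * t ^ 2 + (c - 2 * e * b + 8 * e ^ 3) * t := by
    refine fun s t hst => sub_left_injective (b := e) (h ?_)
    simp only at hst ⊢
    linear_combination hst
  have hb := eq_zero_of_injective_depressed_quartic hq (by omega) hbc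
  exact not_injective_pow_four_add_mul hq (by omega) h3 (c - 2 * e * b + 8 * e ^ 3)
    (by simpa [hb] using hbc)

/-! ### Permutation quartics in characteristic two. -/

theorem card_pow_two_of_charP_two (F : Type*) [Field F] [Fintype F] [CharP F 2] :
    ∃ k : ℕ, Fintype.card F = 2 ^ (k + 1) := by
  obtain ⟨n, -, hn⟩ := FiniteField.card F 2
  exact ⟨n - 1, by rw [hn, Nat.sub_add_cancel n.pos]⟩

/-- In characteristic two, an element of absolute trace zero is of the form `y ^ 2 + y`. -/
theorem exists_sq_add_self_eq_of_sum_pow_eq_zero {F : Type*} [Field F] [Fintype F] [CharP F 2]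
    {k : ℕ} (hk : Fintype.card F = 2 ^ (k + 1)) {w : F}
    (hw : ∑ i ∈ Finset.range (k + 1), w ^ 2 ^ i = 0) : ∃ y : F, y ^ 2 + y = w := by
  classical
  let φ : F →+ F :=
    { toFun := fun y => y ^ 2 + y
      map_zero' := by simp
      map_add' := fun x y => by rw [add_pow_char x y 2]; ring }
  have hker : Nat.card φ.ker ≤ 2 := by
    have : (φ.ker : Set F) ⊆ ({0, 1} : Finset F) := by
      intro y hy
      have hy : y ^ 2 + y = 0 := hy
      rcases mul_eq_zero.1 (by linear_combination hy : y * (y + 1) = 0) with h | h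
      · simp [h]
      · simp [← CharTwo.add_eq_zero, h]
    calc Nat.card φ.ker = (φ.ker : Set F).ncard := rfl
      _ ≤ (({0, 1} : Finset F) : Set F).ncard := Set.ncard_le_ncard this (Finset.finite_toSet _)
      _ ≤ 2 := by rw [Set.ncard_coe_finset]; exact Finset.card_le_two
  have hrange : 2 ^ k ≤ (φ.range : Set F).ncard := by
    have h1 : Nat.card φ.ker * Nat.card φ.range = 2 ^ (k + 1) := by
      rw [← AddSubgroup.index_ker, AddSubgroup.card_mul_index, Nat.card_eq_fintype_card, hk]
    have h2 : Nat.card φ.range = (φ.range : Set F).ncard := rfl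
    rw [pow_succ] at h1
    nlinarith
  set P : F[X] := ∑ i ∈ Finset.range (k + 1), X ^ 2 ^ i with hP
  have hPd : P.natDegree ≤ 2 ^ k := natDegree_sum_le_of_forall_le _ _ fun i hi => by
    rw [natDegree_X_pow]
    exact Nat.pow_le_pow_right (by norm_num) (by simpa [Nat.lt_succ_iff] using hi)
  have hP0 : P ≠ 0 := by
    intro h
    have : P.coeff 1 = 1 := by
      rw [hP, finsetSum_coeff, Finset.sum_eq_single 0]
      · simp
      · intro i _ hi
        rw [coeff_X_pow, if_neg]
        exact (Nat.one_lt_two_pow hi).ne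
      · simp
    rw [h] at this
    simp at this
  have hsub : (φ.range : Set F) ⊆ (P.roots.toFinset : Set F) := by
    rintro _ ⟨y, rfl⟩
    simp only [Finset.mem_coe, Multiset.mem_toFinset, mem_roots hP0, IsRoot.def]
    rw [hP, eval_finsetSum]
    simp only [eval_pow, eval_X]
    have : ∀ i, (φ y) ^ 2 ^ i = y ^ 2 ^ (i + 1) - y ^ 2 ^ i := fun i => by
      change (y ^ 2 + y) ^ 2 ^ i = _
      rw [add_pow_char_pow, CharTwo.sub_eq_add, ← pow_mul, pow_succ']
    simp_rw [this]
    rw [Finset.sum_range_sub (fun i => y ^ 2 ^ i), ← hk, FiniteField.pow_card]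
    simp
  -- The image of $y^2+y$ has at least $2^k$ elements and lies in the zero set of the trace
  -- polynomial, whose degree is at most $2^k$; so the two sets agree.
  have heq := Set.eq_of_subset_of_ncard_le hsub (by
    rw [Set.ncard_coe_finset]
    exact ((Multiset.toFinset_card_le _).trans (card_roots' P)).trans (hPd.trans hrange))
    (Finset.finite_toSet _)
  have : w ∈ (φ.range : Set F) := by
    rw [heq]
    simp only [Finset.mem_coe, Multiset.mem_toFinset, mem_roots hP0, IsRoot.def]
    rw [hP, eval_finsetSum]
    simpa using hw
  exact this

theorem sum_pow_two_pow_eq_zero_or_one {F : Type*} [Field F] [Fintype F] [CharP F 2]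
    {k : ℕ} (hk : Fintype.card F = 2 ^ (k + 1)) (w : F) :
    ∑ i ∈ Finset.range (k + 1), w ^ 2 ^ i = 0 ∨ ∑ i ∈ Finset.range (k + 1), w ^ 2 ^ i = 1 := by
  set T := ∑ i ∈ Finset.range (k + 1), w ^ 2 ^ i with hT
  have h : T ^ 2 - T = 0 := by
    rw [hT, sum_pow_char 2, ← Finset.sum_sub_distrib]
    simp_rw [← pow_mul, ← pow_succ]
    rw [Finset.sum_range_sub (fun i => w ^ 2 ^ i), ← hk, FiniteField.pow_card]
    simp
  rcases mul_eq_zero.1 (by linear_combination h : T * (T - 1) = 0) with h | h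
  · exact Or.inl h
  · exact Or.inr (sub_eq_zero.1 h)

/-- After expansion by Frobenius, only exponents of $d$ divisible by $q-1$ survive summation. The
sole one is $q-1$ itself, from $d \cdot d^{-1}$ at $i = 0$. -/
theorem sum_units_mul_pow_two_pow {F : Type*} [Field F] [Fintype F] [DecidableEq F] [CharP F 2]
    {k : ℕ} (hk : Fintype.card F = 2 ^ (k + 1)) (hk2 : 2 ≤ k) (u v w : F) {i : ℕ}
    (hi : i < k + 1) :
    ∑ d : Fˣ, (d : F) * (u * (d : F)⁻¹ + v * d + w * d ^ 2 + 1) ^ 2 ^ i =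
      if i = 0 then -u else 0 := by
  have hpow : (2 : ℕ) ^ i ≤ 2 ^ k := Nat.pow_le_pow_right (by norm_num) (by omega)
  have h4 : 2 ^ 2 ≤ 2 ^ k := Nat.pow_le_pow_right (by norm_num) hk2
  have hi1 : 1 ≤ 2 ^ i := Nat.one_le_two_pow
  rw [pow_succ] at hk
  have hterm : ∀ d : Fˣ, (d : F) * (u * (d : F)⁻¹ + v * d + w * d ^ 2 + 1) ^ 2 ^ i =
      u ^ 2 ^ i * (d : F) ^ (Fintype.card F - 2 ^ i) + v ^ 2 ^ i * (d : F) ^ (2 ^ i + 1) +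
      w ^ 2 ^ i * (d : F) ^ (2 * 2 ^ i + 1) + (d : F) ^ 1 := by
    intro d
    have hd : (d : F) * ((d : F)⁻¹) ^ 2 ^ i = (d : F) ^ (Fintype.card F - 2 ^ i) := by
      rw [pow_sub₀ _ d.ne_zero (by omega), FiniteField.pow_card, inv_pow]
    rw [add_pow_char_pow, add_pow_char_pow, add_pow_char_pow, ← hd, one_pow]
    ring
  have hnd : ∀ n, n ≠ 0 → n < Fintype.card F - 1 → ¬ Fintype.card F - 1 ∣ n := fun n h0 hn h =>
    absurd (Nat.le_of_dvd (Nat.pos_of_ne_zero h0) h) (by omega)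
  simp_rw [hterm, Finset.sum_add_distrib, ← Finset.mul_sum, FiniteField.sum_pow_units]
  rw [if_neg (hnd (2 ^ i + 1) (by omega) (by omega)), if_neg (hnd 1 (by omega) (by omega)),
    if_neg (c := Fintype.card F - 1 ∣ 2 * 2 ^ i + 1)]
  · rcases Nat.eq_zero_or_pos i with rfl | h0
    · simp
    · have : 2 ^ 1 ≤ 2 ^ i := Nat.pow_le_pow_right (by norm_num) h0
      rw [if_neg (hnd _ (by omega) (by omega)), if_neg h0.ne']
      simp
  · intro h
    rcases (by omega : i < k ∨ i = k) with h' | rfl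
    · have : (2 : ℕ) ^ (i + 1) ≤ 2 ^ k := Nat.pow_le_pow_right (by norm_num) h'
      rw [pow_succ] at this
      exact hnd _ (by omega) (by omega) h
    -- At $i = k$ the exponent is $q+1$, beyond $q-1$, and must be reduced before comparing sizes.
    · rw [show 2 * 2 ^ i + 1 = (Fintype.card F - 1) + 2 by omega,
        Nat.dvd_add_right (dvd_refl _)] at h
      exact hnd 2 (by omega) (by omega) h

/-- With $s = d^{-1}$, one has $g((y+1)s)-g(ys) = as^3(y^2+y+w)$ for $w =
a^{-1}d^{-1}+(b/a)d+(c/a)d^2+1$. Injectivity makes $y^2+y=w$ unsolvable, so $w$ has absolute trace 1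
for every $d \ne 0$. Multiplying by $d$ and summing over $d$ yields $\sum d = 0$ on one side and
$-a^{-1}$ on the other. This needs $q \ge 8$. -/
theorem card_eq_two_of_injective_quartic_of_charP_two {F : Type*} [Field F] [Fintype F]
    [CharP F 2] {a b c : F} (ha : a ≠ 0)
    (h : Function.Injective fun t : F => t ^ 4 + a * t ^ 3 + b * t ^ 2 + c * t) :
    Fintype.card F = 2 := by
  classical
  have h2 : (2 : F) = 0 := CharTwo.two_eq_zero
  obtain ⟨k, hk⟩ := card_pow_two_of_charP_two F
  by_contra hne
  obtain rfl | rfl | hk2 : k = 0 ∨ k = 1 ∨ 2 ≤ k := by omega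
  · exact hne hk
  -- For $q = 4$, Hermite's criterion for the first power reads off the coefficient $a$ of $X^3$.
  · have hd : (X ^ 4 + C a * X ^ 3 + C b * X ^ 2 + C c * X : F[X]).natDegree = 4 := by
      compute_degree!
    have := FiniteField.coeff_pow_eq_zero_of_injective
      (P := X ^ 4 + C a * X ^ 3 + C b * X ^ 2 + C c * X) (m := 1) (by simpa using h)
      (by omega) (by rw [hd]; omega)
    rw [hk] at this
    simp [coeff_X_pow] at this
    exact ha this
  have key : ∀ d : Fˣ, ∑ i ∈ Finset.range (k + 1),
      (a⁻¹ * (d : F)⁻¹ + b / a * d + c / a * d ^ 2 + 1) ^ 2 ^ i = 1 := by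
    intro d
    refine (sum_pow_two_pow_eq_zero_or_one hk _).resolve_left fun h0 => ?_
    obtain ⟨y, hy⟩ := exists_sq_add_self_eq_of_sum_pow_eq_zero hk h0
    have hd : (d : F) ≠ 0 := d.ne_zero
    have := @h ((y + 1) * (d : F)⁻¹) (y * (d : F)⁻¹) (by
      have hw : a * (d : F)⁻¹ ^ 3 * (a⁻¹ * (d : F)⁻¹ + b / a * d + c / a * d ^ 2 + 1) =
          (d : F)⁻¹ ^ 4 + b * (d : F)⁻¹ ^ 2 + c * (d : F)⁻¹ + a * (d : F)⁻¹ ^ 3 := by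
        field_simp
      generalize (d : F)⁻¹ = s at hw hy
      simp only
      linear_combination -hw - a * s ^ 3 * hy + (2 * a * s ^ 3 * (y ^ 2 + y) +
        s ^ 4 * (2 * y ^ 3 + 3 * y ^ 2 + 2 * y) + b * s ^ 2 * y) * h2)
    have h1 : (d : F)⁻¹ = 0 := by linear_combination this
    exact hd (inv_eq_zero.1 h1)
  have hsum : ∑ d : Fˣ, (d : F) * ∑ i ∈ Finset.range (k + 1),
      (a⁻¹ * (d : F)⁻¹ + b / a * d + c / a * d ^ 2 + 1) ^ 2 ^ i = -a⁻¹ := by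
    simp_rw [Finset.mul_sum]
    rw [Finset.sum_comm, Finset.sum_congr rfl fun i hi =>
      sum_units_mul_pow_two_pow hk hk2 _ _ _ (Finset.mem_range.1 hi)]
    simp
  have h4 : 2 ^ 3 ≤ 2 ^ (k + 1) := Nat.pow_le_pow_right (by norm_num) (by omega)
  have h1 := FiniteField.sum_pow_units F 1
  rw [if_neg (fun h => absurd (Nat.le_of_dvd one_pos h) (by omega))] at h1
  simp_rw [key, mul_one] at hsum
  simp_rw [pow_one] at h1
  rw [h1] at hsum
  exact ha (by simpa using hsum.symm)

/-! ### Descent to the subfield of order $Q$ through the norm. -/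

theorem FiniteField.exists_algebra_of_natCard_eq_pow {Q n : ℕ} (hQ : IsPrimePow Q) (hn : n ≠ 0)
    {K : Type*} [Field K] (hK : Nat.card K = Q ^ n) :
    ∃ (F : Type) (_ : Field F) (_ : Fintype F) (_ : Algebra F K),
      Fintype.card F = Q ∧ Module.finrank F K = n := by
  obtain ⟨p, k, hp, hk, rfl⟩ := (isPrimePow_nat_iff Q).1 hQ
  have : Fact p.Prime := ⟨hp⟩
  have : Finite K := Nat.finite_of_card_ne_zero (by
    rw [hK]; exact pow_ne_zero _ (pow_ne_zero _ hp.ne_zero))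
  have : Fintype K := Fintype.ofFinite K
  have : CharP K p := by
    obtain ⟨r, hr⟩ := CharP.exists K
    obtain ⟨m, hrp, hm⟩ := FiniteField.card K r
    rw [← Nat.card_eq_fintype_card, hK] at hm
    have : p ∣ r ^ (m : ℕ) := hm ▸ dvd_pow (dvd_pow_self p hk.ne') hn
    rw [(Nat.prime_dvd_prime_iff_eq hp hrp).1 (hp.dvd_of_dvd_pow this)]
    exact hr
  let : Algebra (ZMod p) K := ZMod.algebra K p
  have hfin : Module.finrank (ZMod p) K = k * n := by
    have h1 := Module.card_eq_pow_finrank (K := ZMod p) (V := K)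
    rw [← Nat.card_eq_fintype_card, hK, ZMod.card, ← pow_mul] at h1
    exact (Nat.pow_right_injective hp.two_le h1).symm
  have : Fintype (GaloisField p k) := Fintype.ofFinite _
  obtain ⟨φ⟩ := FiniteField.nonempty_algHom_of_finrank_dvd (F := ZMod p) (K := GaloisField p k)
    (L := K) (by rw [GaloisField.finrank p hk.ne', hfin]; exact dvd_mul_right _ _)
  let : Algebra (GaloisField p k) K := φ.toRingHom.toAlgebra
  have hcard : Fintype.card (GaloisField p k) = p ^ k := by
    rw [← Nat.card_eq_fintype_card, GaloisField.card p k hk.ne']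
  refine ⟨GaloisField p k, inferInstance, inferInstance, inferInstance, hcard, ?_⟩
  have h1 := Module.card_eq_pow_finrank (K := GaloisField p k) (V := K)
  rw [← Nat.card_eq_fintype_card, hK, hcard] at h1
  exact (Nat.pow_right_injective (Nat.one_lt_pow hk.ne' hp.one_lt) h1).symm

section NormReduction

variable {F K : Type*} [Field F] [Fintype F] [Field K] [Finite K] [Algebra F K]

/-- The norm intertwines the two maps and is surjective, so surjectivity passes down to the finite
field `F`. -/
theorem injective_of_bijective_mul_norm_add {r : ℕ} {α : K}
    (h : Function.Bijective fun x : K => x ^ r * (algebraMap F K (Algebra.norm F x) + α)) :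
    Function.Injective fun t : F => t ^ r * Algebra.norm F (algebraMap F K t + α) := by
  refine Finite.injective_iff_surjective.2 fun t => ?_
  obtain ⟨y, rfl⟩ := FiniteField.norm_surjective F K t
  obtain ⟨x, rfl⟩ := h.2 y
  exact ⟨Algebra.norm F x, by simp⟩

omit [Fintype F] in
-- Equal values have equal norms, so injectivity on `F` gives $N(x)=N(y)$. The common factor
-- $N(y)+\alpha$ then cancels, leaving $x=y$.
theorem bijective_mul_norm_add_of_injective {α : K} (hα : α ≠ 0)
    (h : Function.Injective fun t : F => t * Algebra.norm F (algebraMap F K t + α)) :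
    Function.Bijective fun x : K => x * (algebraMap F K (Algebra.norm F x) + α) := by
  refine Finite.injective_iff_bijective.1 fun x y hxy => ?_
  have hN : Algebra.norm F x = Algebra.norm F y := h (by
    have := congrArg (Algebra.norm F) hxy
    simpa using this)
  simp only [hN] at hxy
  -- Were the factor zero, $N(y)$ and $0$ would have the same image, so $N(y)=0$ and $\alpha = 0$.
  refine mul_right_cancel₀ (fun h0 => hα ?_) hxy
  have : Algebra.norm F y = 0 := h (by simp [h0])
  simpa [this] using h0

theorem algebraMap_norm_add_eq (t : F) (α : K) :
    algebraMap F K (Algebra.norm F (algebraMap F K t + α)) =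
      ∏ i ∈ Finset.range (Module.finrank F K), (algebraMap F K t + α ^ Fintype.card F ^ i) := by
  rw [FiniteField.algebraMap_norm_eq_prod_pow, Nat.card_eq_fintype_card]
  refine Finset.prod_congr rfl fun i _ => ?_
  have hfrob : ∀ z : K, ((FiniteField.frobeniusAlgHom F K) ^ i) z = z ^ Fintype.card F ^ i := by
    intro z
    rw [AlgHom.coe_pow, FiniteField.coe_frobeniusAlgHom, pow_iterate]
  rw [← hfrob, map_add, AlgHom.commutes, hfrob]

theorem exists_norm_add_eq_cubic (hd : Module.finrank F K = 3) (α : K) :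
    ∃ a b c : F,
      algebraMap F K a = α + α ^ Fintype.card F + α ^ Fintype.card F ^ 2 ∧
      algebraMap F K b = α * α ^ Fintype.card F + α * α ^ Fintype.card F ^ 2 +
        α ^ Fintype.card F * α ^ Fintype.card F ^ 2 ∧
      algebraMap F K c = α * α ^ Fintype.card F * α ^ Fintype.card F ^ 2 ∧
      ∀ t : F, Algebra.norm F (algebraMap F K t + α) = t ^ 3 + a * t ^ 2 + b * t + c := by
  have hα : α ^ Fintype.card F ^ 3 = α := by
    have := Fintype.ofFinite K
    rw [← hd, ← Module.card_eq_pow_finrank, FiniteField.pow_card]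
  have ha := FiniteField.algebraMap_trace_eq_sum_pow F K α
  have hb := FiniteField.algebraMap_trace_eq_sum_pow F K (α * α ^ Fintype.card F)
  have hc := FiniteField.algebraMap_norm_eq_prod_pow F K α
  -- The three pairwise products of conjugates are themselves conjugate, so $b$ is the trace of
  -- $\alpha^{1+q}$.
  have hb' : algebraMap F K (Algebra.trace F K (α * α ^ Fintype.card F)) =
      α * α ^ Fintype.card F + α * α ^ Fintype.card F ^ 2 +
        α ^ Fintype.card F * α ^ Fintype.card F ^ 2 := by
    rw [hb, hd]
    have h2 : (α ^ Fintype.card F) ^ Fintype.card F = α ^ Fintype.card F ^ 2 := by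
      rw [← pow_mul, sq]
    have h3 : (α ^ Fintype.card F) ^ Fintype.card F ^ 2 = α := by
      rw [← pow_mul, ← pow_succ', hα]
    simp only [Finset.sum_range_succ, Finset.sum_range_zero, Nat.card_eq_fintype_card, mul_pow,
      pow_zero, pow_one, h2, h3]
    ring
  simp only [hd, Finset.sum_range_succ, Finset.prod_range_succ, Finset.sum_range_zero,
    Finset.prod_range_zero, Nat.card_eq_fintype_card, pow_zero, pow_one, zero_add, one_mul]
    at ha hc
  refine ⟨_, _, _, ha, hb', hc, fun t => (algebraMap F K).injective ?_⟩
  rw [algebraMap_norm_add_eq, hd]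
  simp only [map_add, map_mul, map_pow, ha, hb', hc, Finset.prod_range_succ,
    Finset.prod_range_zero, pow_zero, pow_one, one_mul]
  ring

theorem exists_norm_add_eq_quadratic (hd : Module.finrank F K = 2) (α : K) :
    ∃ a b : F, algebraMap F K a = α + α ^ Fintype.card F ∧
      algebraMap F K b = α * α ^ Fintype.card F ∧
      ∀ t : F, Algebra.norm F (algebraMap F K t + α) = t ^ 2 + a * t + b := by
  have ha := FiniteField.algebraMap_trace_eq_sum_pow F K α
  have hc := FiniteField.algebraMap_norm_eq_prod_pow F K α
  simp only [hd, Finset.sum_range_succ, Finset.prod_range_succ, Finset.sum_range_zero,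
    Finset.prod_range_zero, Nat.card_eq_fintype_card, pow_zero, pow_one, zero_add, one_mul]
    at ha hc
  refine ⟨_, _, ha, hc, fun t => (algebraMap F K).injective ?_⟩
  rw [algebraMap_norm_add_eq, hd]
  simp only [map_add, map_mul, map_pow, ha, hc, Finset.prod_range_succ,
    Finset.prod_range_zero, pow_zero, pow_one, one_mul]
  ring

theorem algebraMap_norm_eq_pow_of_finrank_eq_three (hd : Module.finrank F K = 3) (x : K) :
    algebraMap F K (Algebra.norm F x) = x ^ (Fintype.card F ^ 2 + Fintype.card F + 1) := by
  rw [FiniteField.algebraMap_norm_eq_pow_sum, hd, Nat.card_eq_fintype_card]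
  simp only [Finset.sum_range_succ, Finset.sum_range_zero]
  ring

theorem algebraMap_norm_eq_pow_of_finrank_eq_two (hd : Module.finrank F K = 2) (x : K) :
    algebraMap F K (Algebra.norm F x) = x ^ (Fintype.card F + 1) := by
  rw [FiniteField.algebraMap_norm_eq_pow_sum, hd, Nat.card_eq_fintype_card]
  simp only [Finset.sum_range_succ, Finset.sum_range_zero]
  ring

end NormReduction

/-- A divisor of `X ^ |K| - X` has as many roots in `K` as its degree. -/
theorem FiniteField.ncard_roots_of_dvd {K : Type*} [Field K] [Fintype K] {P : K[X]}
    (hP : P ∣ X ^ Fintype.card K - X) : {x : K | P.eval x = 0}.ncard = P.natDegree := by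
  classical
  have hne : (X ^ Fintype.card K - X : K[X]) ≠ 0 :=
    FiniteField.X_pow_card_sub_X_ne_zero K Fintype.one_lt_card
  have hP0 : P ≠ 0 := ne_zero_of_dvd_ne_zero hne hP
  have hsplit : P.Splits := by
    have := Polynomial.splits_X_pow_nat_card_sub_X (K := K)
    rw [Nat.card_eq_fintype_card] at this
    exact this.of_dvd hne hP
  have hnodup : P.roots.Nodup := by
    refine Multiset.nodup_of_le (roots.le_of_dvd hne hP) ?_
    rw [FiniteField.roots_X_pow_card_sub_X]
    exact Finset.univ.nodup
  have : {x : K | P.eval x = 0} = (P.roots.toFinset : Set K) := by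
    ext x
    simp [hP0]
  rw [this, Set.ncard_coe_finset, Multiset.toFinset_card_of_nodup hnodup]
  exact hsplit.natDegree_eq_card_roots.symm

/-! ### Identities in characteristics 7 and 3, and quartics over the fields of 7 and 3 elements. -/

section CharacteristicSeven

variable {R : Type*} [CommRing R]

theorem pow_eight_eq_of_quartic_eq_zero (h7 : (7 : R) = 0) {y : R}
    (h : y ^ 4 + y ^ 3 + 4 * y ^ 2 + 2 = 0) : y ^ 8 = 1 + y ^ 2 - y ^ 3 := by
  linear_combination (3 - 3 * y ^ 2 - y ^ 3 + y ^ 4) * h +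
    (-1 - y ^ 2 + y ^ 4 + y ^ 5) * h7

/-- Here $y$ stands for $\alpha^6$: the conjugates of $\alpha$ are $\alpha$, $\alpha y$, $\alpha
y^8$. The conclusions are $b = 3a^2$ divided by $\alpha^2$, and $(c+3a^3)^2 = 2$. With the converse
below, the quartic generates modulo 7 the same ideal as these two conditions. -/
theorem coeffs_eq_of_quartic_eq_zero (h7 : (7 : R) = 0) {y : R}
    (h : y ^ 4 + y ^ 3 + 4 * y ^ 2 + 2 = 0) :
    y + y ^ 8 + y * y ^ 8 = 3 * (1 + y + y ^ 8) ^ 2 ∧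
      y * (y * y ^ 8 + 3 * (1 + y + y ^ 8) ^ 3) ^ 2 = 2 := by
  rw [pow_eight_eq_of_quartic_eq_zero h7 h]
  constructor
  · linear_combination (-2 + 2 * y - 3 * y ^ 2) * h +
      (-1 - 2 * y + 2 * y ^ 4 + y ^ 5) * h7
  · linear_combination (-1 + y + y ^ 2 - 2 * y ^ 3 - y ^ 4 - 3 * y ^ 5 + 3 * y ^ 6 - 3 * y ^ 7 - y ^ 8 +
      3 * y ^ 9 - 2 * y ^ 10 + 2 * y ^ 11 + 3 * y ^ 13 + 2 * y ^ 15) * h +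
      (82 * y + 254 * y ^ 2 + 566 * y ^ 3 + 598 * y ^ 4 + 392 * y ^ 5 - 291 * y ^ 6 -
      509 * y ^ 7 - 536 * y ^ 8 + 82 * y ^ 9 + 182 * y ^ 10 + 282 * y ^ 11 - 66 * y ^
      12 - 30 * y ^ 13 - 84 * y ^ 14 + 36 * y ^ 15 - 3 * y ^ 16 + 10 * y ^ 17 - 8 * y ^
      18 + y ^ 19) * h7

theorem quartic_eq_zero_of_coeffs_eq (h7 : (7 : R) = 0) {y : R}
    (h₁ : y + y ^ 8 + y * y ^ 8 = 3 * (1 + y + y ^ 8) ^ 2)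
    (h₂ : y * (y * y ^ 8 + 3 * (1 + y + y ^ 8) ^ 3) ^ 2 = 2) :
    y ^ 4 + y ^ 3 + 4 * y ^ 2 + 2 = 0 := by
  linear_combination (3 + y - y ^ 2 + 2 * y ^ 3 - 2 * y ^ 4 - 2 * y ^ 5 + y ^ 6 - 3 * y ^ 7 - 3 * y ^ 8
      + y ^ 9 - 2 * y ^ 11 - 3 * y ^ 12 + y ^ 13 - 3 * y ^ 15 + y ^ 16 - 3 * y ^ 17 + y
      ^ 18 - 2 * y ^ 19 + 2 * y ^ 20 - y ^ 21 - 3 * y ^ 22 + 2 * y ^ 23 + 3 * y ^ 24 -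
      y ^ 25 - 2 * y ^ 26 + 3 * y ^ 27 + 3 * y ^ 28 - 2 * y ^ 29 + 2 * y ^ 31 - 2 * y ^
      32 + y ^ 33 - 2 * y ^ 34 + 2 * y ^ 35 + y ^ 36 - y ^ 37 - 2 * y ^ 38 + 3 * y ^ 39
      + 3 * y ^ 40 - 3 * y ^ 41 + y ^ 42 + 2 * y ^ 43 + 3 * y ^ 44) * h₁ +
    (-2 + 3 * y + y ^ 2 - 3 * y ^ 3 - 3 * y ^ 5 + y ^ 6 + y ^ 7 - y ^ 8 - 2 * y ^ 9 +
      3 * y ^ 10 + y ^ 11) * h₂ +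
    (1 + 6 * y + 14 * y ^ 2 + 14 * y ^ 3 - 10 * y ^ 4 - 37 * y ^ 5 - 8 * y ^ 6 + 58 *
      y ^ 7 + 94 * y ^ 8 + 88 * y ^ 9 + 83 * y ^ 10 + 43 * y ^ 11 - 82 * y ^ 12 - 131 *
      y ^ 13 + 27 * y ^ 14 + 218 * y ^ 15 + 258 * y ^ 16 + 175 * y ^ 17 + 113 * y ^ 18
      + 21 * y ^ 19 - 164 * y ^ 20 - 172 * y ^ 21 + 51 * y ^ 22 + 252 * y ^ 23 + 258 *
      y ^ 24 + 103 * y ^ 25 + 56 * y ^ 26 + 16 * y ^ 27 - 145 * y ^ 28 - 178 * y ^ 29 -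
      34 * y ^ 30 + 151 * y ^ 31 + 119 * y ^ 32 - 18 * y ^ 33 + 44 * y ^ 34 + 37 * y ^
      35 - 113 * y ^ 36 - 167 * y ^ 37 - 45 * y ^ 38 + 75 * y ^ 39 + 3 * y ^ 40 - 23 *
      y ^ 41 + 49 * y ^ 42 + 11 * y ^ 43 - 77 * y ^ 44 - 72 * y ^ 45 + 3 * y ^ 46 + 17
      * y ^ 47 - 12 * y ^ 48 + 3 * y ^ 49 + 17 * y ^ 50 - 6 * y ^ 51 - 23 * y ^ 52 - 6
      * y ^ 53 + 3 * y ^ 54 + 3 * y ^ 58 - 3 * y ^ 59) * h7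

/-- The exponent comes from $6 \cdot 57 = 7^3-1$; it is applied to $y = X^6$. -/
theorem quartic_dvd_pow_sub_one (h7 : (7 : R) = 0) (y : R) :
    y ^ 4 + y ^ 3 + 4 * y ^ 2 + 2 ∣ y ^ 57 - 1 := by
  refine ⟨3 + y ^ 2 + 2 * y ^ 3 - y ^ 5 + 2 * y ^ 6 + y ^ 7 + y ^ 9 + 2 * y ^ 10 + y ^ 11 -
      y ^ 12 - 3 * y ^ 14 + 3 * y ^ 16 - 2 * y ^ 17 - y ^ 18 - y ^ 19 - 2 * y ^ 20 - 2
      * y ^ 22 - 2 * y ^ 23 - 2 * y ^ 24 - 2 * y ^ 25 - y ^ 26 - y ^ 27 - 3 * y ^ 28 +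
      2 * y ^ 31 - 2 * y ^ 32 + 3 * y ^ 33 + 3 * y ^ 34 + y ^ 35 - 3 * y ^ 36 + 2 * y ^
      37 - 3 * y ^ 38 - 3 * y ^ 39 + 3 * y ^ 40 + 3 * y ^ 41 - 3 * y ^ 42 + y ^ 43 + 3
      * y ^ 44 - 2 * y ^ 45 + 2 * y ^ 46 + 2 * y ^ 47 - y ^ 48 + 3 * y ^ 49 - 3 * y ^
      51 - y ^ 52 + y ^ 53, ?_⟩
  linear_combination (-1 - 2 * y ^ 2 - y ^ 3 - y ^ 4 - y ^ 5 - y ^ 6 - y ^ 8 - y ^ 9 - y ^ 10 - y ^ 11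
      - y ^ 12 - y ^ 13 + y ^ 14 + y ^ 16 + y ^ 17 - y ^ 18 + y ^ 19 + y ^ 20 + y ^ 21
      + 2 * y ^ 22 + y ^ 23 + 2 * y ^ 24 + 2 * y ^ 25 + 2 * y ^ 26 + 2 * y ^ 27 + 2 * y
      ^ 28 + y ^ 29 + 2 * y ^ 30 + y ^ 32 - 2 * y ^ 33 - 2 * y ^ 35 - y ^ 36 - 2 * y ^
      37 + 2 * y ^ 38 + y ^ 40 + y ^ 41 - 2 * y ^ 43 - 2 * y ^ 46 - y ^ 48 - 2 * y ^ 49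
      - y ^ 51 + y ^ 53 + y ^ 54) * h7

end CharacteristicSeven

theorem dvd_pow_twentySix_sub_one {R : Type*} [CommRing R] (h3 : (3 : R) = 0) (y : R) :
    y ^ 12 + y ^ 10 + y ^ 4 + 1 ∣ y ^ 26 - 1 := by
  refine ⟨-1 + y ^ 4 - y ^ 8 + y ^ 10 - y ^ 12 + y ^ 14, ?_⟩
  linear_combination (y ^ 12 - y ^ 14) * h3

/-- As a function on $\mathbb F_3$ the quartic is $(1+b)t^2+(a+c)t$. -/
theorem ZMod.injective_quartic_three_iff (a b c : ZMod 3) :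
    Function.Injective (fun t => t ^ 4 + a * t ^ 3 + b * t ^ 2 + c * t) ↔
      b + 1 = 0 ∧ a + c ≠ 0 := by
  revert a b c
  unfold Function.Injective
  decide

/-- Removing the cubic term by $t \mapsto t-2a$ leaves quadratic coefficient $b-3a^2$; when this
vanishes the linear coefficient is $c+3a^3$. The only permuting quartics $t^4+\gamma t$ have $\gamma
= \pm 3$. -/
theorem ZMod.injective_quartic_seven_iff (a b c : ZMod 7) :
    Function.Injective (fun t => t ^ 4 + a * t ^ 3 + b * t ^ 2 + c * t) ↔
      b = 3 * a ^ 2 ∧ (c + 3 * a ^ 3) ^ 2 = 2 := by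
  revert a b c
  unfold Function.Injective
  decide +kernel

theorem RingEquiv.injective_quartic_iff {R S : Type*} [CommRing R] [CommRing S] (e : R ≃+* S)
    (a b c : R) :
    Function.Injective (fun t : S => t ^ 4 + e a * t ^ 3 + e b * t ^ 2 + e c * t) ↔
      Function.Injective (fun t : R => t ^ 4 + a * t ^ 3 + b * t ^ 2 + c * t) := by
  have : (fun t : S => t ^ 4 + e a * t ^ 3 + e b * t ^ 2 + e c * t) =
      e ∘ (fun t : R => t ^ 4 + a * t ^ 3 + b * t ^ 2 + c * t) ∘ e.symm := by
    ext t
    simp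
  rw [this, e.injective.of_comp_iff]
  exact e.symm.toEquiv.injective_comp _

theorem injective_quartic_iff_of_card_eq_three {F : Type*} [Field F] [Fintype F]
    (hF : Fintype.card F = 3) (a b c : F) :
    Function.Injective (fun t => t ^ 4 + a * t ^ 3 + b * t ^ 2 + c * t) ↔
      b + 1 = 0 ∧ a + c ≠ 0 := by
  let e := ZMod.ringEquivOfPrime F Nat.prime_three hF
  obtain ⟨a, rfl⟩ := e.surjective a
  obtain ⟨b, rfl⟩ := e.surjective b
  obtain ⟨c, rfl⟩ := e.surjective c
  rw [e.injective_quartic_iff, ZMod.injective_quartic_three_iff, ← e.injective.eq_iff,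
    ← e.injective.ne_iff]
  simp

theorem injective_quartic_iff_of_card_eq_seven {F : Type*} [Field F] [Fintype F]
    (hF : Fintype.card F = 7) (a b c : F) :
    Function.Injective (fun t => t ^ 4 + a * t ^ 3 + b * t ^ 2 + c * t) ↔
      b = 3 * a ^ 2 ∧ (c + 3 * a ^ 3) ^ 2 = 2 := by
  let e := ZMod.ringEquivOfPrime F (by norm_num) hF
  obtain ⟨a, rfl⟩ := e.surjective a
  obtain ⟨b, rfl⟩ := e.surjective b
  obtain ⟨c, rfl⟩ := e.surjective c
  rw [e.injective_quartic_iff, ZMod.injective_quartic_seven_iff, ← e.injective.eq_iff,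
    ← e.injective.eq_iff]
  have e2 : e 2 = 2 := map_ofNat e 2
  have e3 : e 3 = 3 := map_ofNat e 3
  simp [e2, e3]

/-! ### The first family, over the cubic extension. -/

section CubicExtension

variable {F K : Type*} [Field F] [Fintype F] [Field K] [Finite K] [Algebra F K]

theorem charP_two_of_even_card (h : Even (Fintype.card F)) : CharP F 2 := by
  have := FiniteField.even_card_iff_char_two.2 (Nat.even_iff.1 h)
  exact ringChar.of_eq this

theorem permutesField_iff_injective (hd : Module.finrank F K = 3) {α : K} (hα : α ≠ 0) :
    PermutesField (X ^ (Fintype.card F ^ 2 + Fintype.card F + 2) + C α * X : K[X]) ↔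
      Function.Injective fun t : F => t * Algebra.norm F (algebraMap F K t + α) := by
  have : (fun x : K => (X ^ (Fintype.card F ^ 2 + Fintype.card F + 2) + C α * X : K[X]).eval x) =
      fun x => x * (algebraMap F K (Algebra.norm F x) + α) := by
    ext x
    rw [algebraMap_norm_eq_pow_of_finrank_eq_three hd]
    simp
    ring
  rw [PermutesField, this]
  refine ⟨fun h => ?_, bijective_mul_norm_add_of_injective hα⟩
  simpa using injective_of_bijective_mul_norm_add (r := 1) (α := α) (by simpa using h)

theorem permutesField_iff_trace_eq_zero_or (hd : Module.finrank F K = 3)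
    (hF : Even (Fintype.card F)) {α : K} (hα : α ≠ 0) :
    PermutesField (X ^ (Fintype.card F ^ 2 + Fintype.card F + 2) + C α * X : K[X]) ↔
      α ^ (Fintype.card F ^ 2) + α ^ Fintype.card F + α = 0 ∨ (Fintype.card F = 2 ∧ α ≠ 1) := by
  have := charP_two_of_even_card hF
  have h2 : (2 : F) = 0 := CharTwo.two_eq_zero
  have h2K : (2 : K) = 0 := by
    rw [← map_ofNat (algebraMap F K) 2, h2, map_zero]
  obtain ⟨a, b, c, ha, hb, hc, hN⟩ := exists_norm_add_eq_cubic hd α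
  have ha' : a = 0 ↔ α ^ (Fintype.card F ^ 2) + α ^ Fintype.card F + α = 0 := by
    rw [← (algebraMap F K).injective.eq_iff, ha, map_zero]
    ring_nf
  rw [permutesField_iff_injective hd hα, ← ha']
  have hg : (fun t : F => t * Algebra.norm F (algebraMap F K t + α)) =
      fun t => t ^ 4 + a * t ^ 3 + b * t ^ 2 + c * t := by
    ext t
    rw [hN]
    ring
  constructor
  · intro h
    by_cases ha0 : a = 0
    · exact Or.inl ha0
    · refine Or.inr ⟨card_eq_two_of_injective_quartic_of_charP_two (b := b) (c := c) ha0
        (by rwa [hg] at h), ?_⟩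
      rintro rfl
      have := @h 1 0 (by simp [one_add_one_eq_two, h2K])
      exact one_ne_zero this
  -- A nonzero root $t$ has $N(t+\alpha)=0$, so $\alpha = -t = t$ lies in `F`.
  · have hroot : ∀ t : F, algebraMap F K t ≠ α → t * Algebra.norm F (algebraMap F K t + α) = 0 →
        t = 0 := by
      intro t ht h
      refine (mul_eq_zero.1 h).resolve_right fun h => ht ?_
      rw [Algebra.norm_eq_zero_iff] at h
      linear_combination h - α * h2K
    rintro (ha0 | ⟨hcard, hα1⟩)
    · intro s t hst
      -- If $\alpha$ lay in `F`, its trace would be $3\alpha = \alpha \ne 0$.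
      have hα' : algebraMap F K (s + t) ≠ α := by
        intro h
        have hpow : α ^ Fintype.card F = α := by
          rw [← h, ← map_pow, FiniteField.pow_card]
        have htr := ha'.1 ha0
        rw [sq, pow_mul, hpow, hpow] at htr
        exact hα (by linear_combination htr - α * h2K)
      have h0 := hroot (s + t) hα' (by
        have e := congrFun hg
        simp only at e hst
        rw [e, e] at hst
        rw [e, ha0]
        rw [ha0] at hst
        linear_combination hst + (2 * s ^ 3 * t + 3 * s ^ 2 * t ^ 2 + 2 * s * t ^ 3 + t ^ 4 + b * s * t + b * t ^ 2 + c * t) * h2)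
      exact CharTwo.add_eq_zero.1 h0
    · intro s t hst
      have h01 : ∀ t : F, t = 0 ∨ t = 1 := by
        intro t
        have := FiniteField.pow_card t
        rw [hcard] at this
        rcases mul_eq_zero.1 (by linear_combination this : t * (t - 1) = 0) with h | h
        · exact Or.inl h
        · exact Or.inr (sub_eq_zero.1 h)
      have hne := hroot 1 (by simpa using hα1.symm)
      simp only at hst
      rcases h01 s with rfl | rfl <;> rcases h01 t with rfl | rfl
      · rfl
      · rw [zero_mul] at hst
        exact (hne hst.symm).symm
      · rw [zero_mul] at hst
        exact hne hst
      · rfl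

theorem permutesField_iff_of_card_eq_three (hd : Module.finrank F K = 3)
    (hF : Fintype.card F = 3) {α : K} (hα : α ≠ 0) :
    PermutesField (X ^ (Fintype.card F ^ 2 + Fintype.card F + 2) + C α * X : K[X]) ↔
      α ^ 12 + α ^ 10 + α ^ 4 + 1 = 0 := by
  obtain ⟨a, b, c, ha, hb, hc, hN⟩ := exists_norm_add_eq_cubic hd α
  have h3 : (3 : F) = 0 := by
    rw [← Nat.cast_ofNat, ← hF, FiniteField.cast_card_eq_zero]
  have h3K : (3 : K) = 0 := by
    rw [← map_ofNat (algebraMap F K) 3, h3, map_zero]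
  rw [permutesField_iff_injective hd hα]
  have hg : (fun t : F => t * Algebra.norm F (algebraMap F K t + α)) =
      fun t => t ^ 4 + a * t ^ 3 + b * t ^ 2 + c * t := by
    ext t
    rw [hN]
    ring
  have hb1 : b + 1 = 0 ↔ α ^ 12 + α ^ 10 + α ^ 4 + 1 = 0 := by
    rw [← (algebraMap F K).injective.eq_iff, map_add, hb, map_zero, map_one, hF]
    ring_nf
  rw [hg, injective_quartic_iff_of_card_eq_three hF, hb1]
  -- The condition $a+c \ne 0$ is automatic: otherwise $N(1+\alpha) = 1+a+b+c = 0$, so $\alpha =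
  -- -1$, where the polynomial takes the value $4 = 1$.
  refine ⟨And.left, fun h => ⟨h, fun hac => ?_⟩⟩
  have hroot : ∀ t : F, t ^ 2 = 1 → α ≠ algebraMap F K t := by
    intro t ht hαt
    rw [hαt] at h
    have hf : (t ^ 12 + t ^ 10 + t ^ 4 + 1 : F) = 0 := (algebraMap F K).injective (by simpa using h)
    have : (1 : F) = 0 := by
      have hf' : (t ^ 2) ^ 6 + (t ^ 2) ^ 5 + (t ^ 2) ^ 2 + 1 = 0 := by linear_combination hf
      rw [ht] at hf'
      linear_combination hf' - h3
    exact one_ne_zero this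
  have h1 := hN 1
  have hb0 : b + 1 = 0 := hb1.2 h
  rw [show (1 : F) ^ 3 + a * 1 ^ 2 + b * 1 + c = 0 by linear_combination hac + hb0,
    Algebra.norm_eq_zero_iff] at h1
  refine hroot (-1) (by norm_num) ?_
  rw [map_neg]
  rw [map_one] at h1 ⊢
  linear_combination h1

theorem permutesField_iff_of_card_eq_seven (hd : Module.finrank F K = 3)
    (hF : Fintype.card F = 7) {α : K} (hα : α ≠ 0) :
    PermutesField (X ^ (Fintype.card F ^ 2 + Fintype.card F + 2) + C α * X : K[X]) ↔
      α ^ 24 + α ^ 18 + 4 * α ^ 12 + 2 = 0 := by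
  obtain ⟨a, b, c, ha, hb, hc, hN⟩ := exists_norm_add_eq_cubic hd α
  have h7 : (7 : F) = 0 := by
    rw [← Nat.cast_ofNat, ← hF, FiniteField.cast_card_eq_zero]
  have h7K : (7 : K) = 0 := by
    rw [← map_ofNat (algebraMap F K) 7, h7, map_zero]
  rw [permutesField_iff_injective hd hα]
  have hg : (fun t : F => t * Algebra.norm F (algebraMap F K t + α)) =
      fun t => t ^ 4 + a * t ^ 3 + b * t ^ 2 + c * t := by
    ext t
    rw [hN]
    ring
  have e1 : b = 3 * a ^ 2 ↔ α ^ 6 + (α ^ 6) ^ 8 + α ^ 6 * (α ^ 6) ^ 8 =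
      3 * (1 + α ^ 6 + (α ^ 6) ^ 8) ^ 2 := by
    rw [← (algebraMap F K).injective.eq_iff, map_mul, map_pow, ha, hb, hF, map_ofNat]
    exact ⟨fun h => mul_left_cancel₀ (pow_ne_zero 2 hα) (by linear_combination h),
      fun h => by linear_combination α ^ 2 * h⟩
  have e2 : (c + 3 * a ^ 3) ^ 2 = 2 ↔ α ^ 6 * (α ^ 6 * (α ^ 6) ^ 8 +
      3 * (1 + α ^ 6 + (α ^ 6) ^ 8) ^ 3) ^ 2 = 2 := by
    rw [← (algebraMap F K).injective.eq_iff, map_pow, map_add, map_mul, map_pow, ha, hc, hF,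
      map_ofNat, map_ofNat]
    ring_nf
  have e3 : α ^ 24 + α ^ 18 + 4 * α ^ 12 + 2 =
      (α ^ 6) ^ 4 + (α ^ 6) ^ 3 + 4 * (α ^ 6) ^ 2 + 2 := by ring
  rw [hg, injective_quartic_iff_of_card_eq_seven hF, e1, e2, e3]
  exact ⟨fun h => quartic_eq_zero_of_coeffs_eq h7K h.1 h.2, coeffs_eq_of_quartic_eq_zero h7K⟩

theorem card_eq_three_or_seven_of_permutesField (hd : Module.finrank F K = 3)
    (hF : ¬ Even (Fintype.card F)) {α : K} (hα : α ≠ 0)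
    (h : PermutesField (X ^ (Fintype.card F ^ 2 + Fintype.card F + 2) + C α * X : K[X])) :
    Fintype.card F = 3 ∨ Fintype.card F = 7 := by
  obtain ⟨a, b, c, -, -, -, hN⟩ := exists_norm_add_eq_cubic hd α
  rw [permutesField_iff_injective hd hα] at h
  refine card_eq_three_or_seven_of_injective_quartic (Nat.not_even_iff_odd.1 hF)
    (a := a) (b := b) (c := c) ?_
  convert h using 2 with t
  rw [hN]
  ring

end CubicExtension

/-! ### The second family, over the quadratic extension. -/

theorem not_permutesField_of_odd {L : Type*} [Field L] {Q : ℕ} (hQ : ¬ Even Q)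
    (h2 : (2 : L) ≠ 0) (α : L) :
    ¬ PermutesField (X ^ (Q + 3) + C α * X ^ 2 : L[X]) := by
  intro h
  have hev : Even (Q + 3) := (Nat.not_even_iff_odd.1 hQ).add_odd (by decide)
  have : (1 : L) = -1 := h.1 (by simp [hev.neg_one_pow])
  exact h2 (by linear_combination this)

theorem card_eq_two_of_permutesField {F L : Type*} [Field F] [Fintype F] [Field L] [Finite L]
    [Algebra F L] (hd : Module.finrank F L = 2) (hF : Even (Fintype.card F)) {α : L}
    (hα : α ≠ 0) (h : PermutesField (X ^ (Fintype.card F + 3) + C α * X ^ 2 : L[X])) :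
    Fintype.card F = 2 ∧ α ≠ 1 := by
  have := charP_two_of_even_card hF
  have h2 : (2 : F) = 0 := CharTwo.two_eq_zero
  have h2L : (2 : L) = 0 := by
    rw [← map_ofNat (algebraMap F L) 2, h2, map_zero]
  obtain ⟨a, b, ha, hb, hN⟩ := exists_norm_add_eq_quadratic hd α
  have hf : (fun x : L => (X ^ (Fintype.card F + 3) + C α * X ^ 2 : L[X]).eval x) =
      fun x => x ^ 2 * (algebraMap F L (Algebra.norm F x) + α) := by
    ext x
    rw [algebraMap_norm_eq_pow_of_finrank_eq_two hd]
    simp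
    ring
  have hg : Function.Injective fun t : F => t ^ 4 + a * t ^ 3 + b * t ^ 2 + 0 * t := by
    have := injective_of_bijective_mul_norm_add (F := F) (r := 2) (α := α) (hf ▸ h)
    convert this using 2 with t
    rw [hN]
    ring
  -- If $a = 0$ the quartic is $t^2(t^2+b)$ with $b = N(\alpha) \ne 0$, and the square root of $b$
  -- collides with $0$.
  have ha0 : a ≠ 0 := by
    rintro rfl
    have hb0 : b ≠ 0 := by
      rintro rfl
      rw [map_zero] at hb
      exact mul_ne_zero hα (pow_ne_zero _ hα) hb.symm
    obtain ⟨t, ht⟩ := FiniteField.isSquare_of_char_two (ringChar.eq F 2) b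
    have : t = 0 := hg (by
      simp only
      rw [ht]
      linear_combination t ^ 4 * h2)
    exact hb0 (by rw [ht, this, zero_mul])
  refine ⟨card_eq_two_of_injective_quartic_of_charP_two ha0 hg, ?_⟩
  rintro rfl
  have : (1 : L) = 0 := h.1 (by simp [one_add_one_eq_two, h2L])
  exact one_ne_zero this

/-- On $\mathbb F_4$, $x^5 = x^2$, so the map is $(1+\alpha)x^2$, and squaring is bijective. -/
theorem permutesField_of_card_eq_four {L : Type*} [Field L] [Fintype L]
    (hL : Fintype.card L = 4) {α : L} (hα : α ≠ 1) :
    PermutesField (X ^ (2 + 3) + C α * X ^ 2 : L[X]) := by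
  have h4 : (4 : L) = 0 := by
    rw [← Nat.cast_ofNat, ← hL, FiniteField.cast_card_eq_zero]
  have h2 : (2 : L) = 0 := pow_eq_zero_iff two_ne_zero |>.1 (by linear_combination h4 : (2 : L) ^ 2 = 0)
  refine Finite.injective_iff_bijective.1 fun x y hxy => ?_
  have hx := FiniteField.pow_card x
  have hy := FiniteField.pow_card y
  rw [hL] at hx hy
  simp at hxy
  have h1 : (1 + α) * (x - y) ^ 2 = 0 := by
    linear_combination hxy - x * hx + y * hy + (1 + α) * (y ^ 2 - x * y) * h2
  rcases mul_eq_zero.1 h1 with h | h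
  · exact absurd (by linear_combination h - h2) hα
  · exact sub_eq_zero.1 (pow_eq_zero_iff two_ne_zero |>.1 h)

/-! ### Counting the admissible $\alpha$. -/

theorem ncard_trace_eq_zero {K : Type*} [Field K] [Fintype K] {Q : ℕ} (hQ : IsPrimePow Q)
    (hK : Fintype.card K = Q ^ 3) (hev : Even Q) :
    {α : K | α ≠ 0 ∧ α ^ (Q ^ 2) + α ^ Q + α = 0}.ncard = Q ^ 2 - 1 := by
  obtain ⟨p, k, hp, hk, rfl⟩ := (isPrimePow_nat_iff Q).1 hQ
  obtain rfl : 2 = p :=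
    (Nat.prime_dvd_prime_iff_eq Nat.prime_two hp).1 (Nat.prime_two.dvd_of_dvd_pow hev.two_dvd)
  have : CharP K 2 := charP_two_of_even_card (hK ▸ hev.pow_of_ne_zero three_ne_zero)
  set Q := 2 ^ k with hQk
  have hQ1 : 1 < Q := hQ.one_lt
  set P : K[X] := X ^ Q ^ 2 + X ^ Q + X with hP
  -- The $Q$-th power is additive, so $P^Q - P$ telescopes to $X^{Q^3}-X$.
  have hdvd : P ∣ X ^ Fintype.card K - X := by
    have : P ^ Q = X ^ Q ^ 3 + X ^ Q ^ 2 + X ^ Q := by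
      have hadd : ∀ f g : K[X], (f + g) ^ Q = f ^ Q + g ^ Q := fun f g => add_pow_char_pow f g 2 k
      rw [hP, hadd, hadd, ← pow_mul X (Q ^ 2) Q, ← pow_mul X Q Q, ← pow_succ Q 2, ← sq Q]
    rw [hK, show (X ^ Q ^ 3 - X : K[X]) = P ^ Q - P by rw [this, hP]; ring]
    exact dvd_sub (dvd_pow_self P (by omega)) dvd_rfl
  have hdeg : P.natDegree = Q ^ 2 := by
    have h1 : Q < Q ^ 2 := by nlinarith
    have h2 : (X ^ Q + X : K[X]).natDegree < Q ^ 2 := by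
      refine (natDegree_add_le _ _).trans_lt ?_
      rw [natDegree_X_pow, natDegree_X]
      omega
    rw [hP, add_assoc, natDegree_add_eq_left_of_natDegree_lt (by rwa [natDegree_X_pow]),
      natDegree_X_pow]
  have hset : {α : K | α ≠ 0 ∧ α ^ Q ^ 2 + α ^ Q + α = 0} = {x | P.eval x = 0} \ {0} := by
    ext x
    simp [hP, and_comm]
  have hQ0 : Q ≠ 0 := by omega
  rw [hset, Set.ncard_sdiff_singleton_of_mem (by simp [hP, hQ0]),
    FiniteField.ncard_roots_of_dvd hdvd, hdeg]

theorem ncard_roots_of_card_eq_pow_seven {K : Type*} [Field K] [Fintype K]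
    (hK : Fintype.card K = 7 ^ 3) :
    {α : K | α ≠ 0 ∧ α ^ 24 + α ^ 18 + 4 * α ^ 12 + 2 = 0}.ncard = 24 := by
  have h7 : (7 : K) = 0 := by
    have := FiniteField.cast_card_eq_zero K
    rw [hK, Nat.cast_pow, Nat.cast_ofNat] at this
    exact pow_eq_zero_iff three_ne_zero |>.1 this
  set P : K[X] := X ^ 24 + X ^ 18 + 4 * X ^ 12 + 2 with hP
  have hdvd : P ∣ X ^ Fintype.card K - X := by
    have h7X : (7 : K[X]) = 0 := by
      rw [← map_ofNat C 7, h7, map_zero]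
    have := (quartic_dvd_pow_sub_one h7X (X ^ 6 : K[X])).mul_right X
    convert this using 1
    · rw [hP]; ring
    · rw [hK]; ring
  have hdeg : P.natDegree = 24 := by
    rw [hP]
    compute_degree!
  refine Eq.trans (congrArg Set.ncard ?_) ((FiniteField.ncard_roots_of_dvd hdvd).trans hdeg)
  ext x
  simp only [Set.mem_ofPred_eq, hP, eval_add, eval_mul, eval_pow, eval_X, eval_ofNat]
  refine ⟨And.right, fun h => ⟨?_, h⟩⟩
  rintro rfl
  exact one_ne_zero (by linear_combination 4 * h - h7 : (1 : K) = 0)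

theorem ncard_roots_of_card_eq_pow_three {K : Type*} [Field K] [Fintype K]
    (hK : Fintype.card K = 3 ^ 3) :
    {α : K | α ≠ 0 ∧ α ^ 12 + α ^ 10 + α ^ 4 + 1 = 0}.ncard = 12 := by
  have h3 : (3 : K) = 0 := by
    have := FiniteField.cast_card_eq_zero K
    rw [hK, Nat.cast_pow, Nat.cast_ofNat] at this
    exact pow_eq_zero_iff three_ne_zero |>.1 this
  set P : K[X] := X ^ 12 + X ^ 10 + X ^ 4 + 1 with hP
  have hdvd : P ∣ X ^ Fintype.card K - X := by
    have h3X : (3 : K[X]) = 0 := by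
      rw [← map_ofNat C 3, h3, map_zero]
    have := (dvd_pow_twentySix_sub_one h3X (X : K[X])).mul_right X
    convert this using 1
    rw [hK]; ring
  have hdeg : P.natDegree = 12 := by
    rw [hP]
    compute_degree!
  refine Eq.trans (congrArg Set.ncard ?_) ((FiniteField.ncard_roots_of_dvd hdvd).trans hdeg)
  ext x
  simp only [Set.mem_ofPred_eq, hP, eval_add, eval_pow, eval_X, eval_one]
  refine ⟨And.right, fun h => ⟨?_, h⟩⟩
  rintro rfl
  exact one_ne_zero (by linear_combination h : (1 : K) = 0)

theorem ncard_ne_zero_ne_one {K : Type*} [Field K] [Fintype K] (hK : Fintype.card K = 2 ^ 3) :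
    {α : K | α ≠ 0 ∧ α ≠ 1}.ncard = 6 := by
  have : {α : K | α ≠ 0 ∧ α ≠ 1} = ({0, 1} : Set K)ᶜ := by
    ext x
    simp
  rw [this, Set.ncard_compl, Set.ncard_pair zero_ne_one, Nat.card_eq_fintype_card, hK]
  norm_num

/-! ### Assembly by the parity of $Q$. -/

theorem corollary2p4 (Q : ℕ) (hQ : IsPrimePow Q) :
    (∀ (K : Type*) [Field K], Nat.card K = Q ^ 3 →
      (∀ α : K, α ≠ 0 →
        (PermutesField (X ^ (Q ^ 2 + Q + 2) + C α * X : K[X]) ↔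
          (Even Q ∧ α ^ (Q ^ 2) + α ^ Q + α = 0) ∨
          (Q = 7 ∧ α ^ 24 + α ^ 18 + 4 * α ^ 12 + 2 = 0) ∨
          (Q = 3 ∧ α ^ 12 + α ^ 10 + α ^ 4 + 1 = 0) ∨
          (Q = 2 ∧ α ≠ 1))) ∧
      (Even Q → {α : K | α ≠ 0 ∧ α ^ (Q ^ 2) + α ^ Q + α = 0}.ncard = Q ^ 2 - 1) ∧
      (Q = 7 → {α : K | α ≠ 0 ∧ α ^ 24 + α ^ 18 + 4 * α ^ 12 + 2 = 0}.ncard = 24) ∧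
      (Q = 3 → {α : K | α ≠ 0 ∧ α ^ 12 + α ^ 10 + α ^ 4 + 1 = 0}.ncard = 12) ∧
      (Q = 2 → {α : K | α ≠ 0 ∧ α ≠ 1}.ncard = 6)) ∧
    (∀ (L : Type*) [Field L], Nat.card L = Q ^ 2 →
      ∀ α : L, α ≠ 0 →
        (PermutesField (X ^ (Q + 3) + C α * X ^ 2 : L[X]) ↔ Q = 2 ∧ α ≠ 1)) := by
  refine ⟨fun K _ hK => ?_, fun L _ hL α hα => ?_⟩
  · have : Finite K := Nat.finite_of_card_ne_zero (by rw [hK]; exact pow_ne_zero _ hQ.ne_zero)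
    let : Fintype K := Fintype.ofFinite K
    have hK' : Fintype.card K = Q ^ 3 := by rw [← Nat.card_eq_fintype_card, hK]
    refine ⟨fun α hα => ?_, ncard_trace_eq_zero hQ hK', ?_, ?_, ?_⟩
    · obtain ⟨F, _, _, _, rfl, hd⟩ := FiniteField.exists_algebra_of_natCard_eq_pow hQ three_ne_zero hK
      by_cases hF : Even (Fintype.card F)
      · have h7 : Fintype.card F ≠ 7 := fun h => by rw [h] at hF; revert hF; decide
        have h3 : Fintype.card F ≠ 3 := fun h => by rw [h] at hF; revert hF; decide
        rw [permutesField_iff_trace_eq_zero_or hd hF hα]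
        tauto
      · have h2 : Fintype.card F ≠ 2 := fun h => hF (h ▸ even_two)
        constructor
        · intro h
          rcases card_eq_three_or_seven_of_permutesField hd hF hα h with h3 | h7
          · exact Or.inr (Or.inr (Or.inl ⟨h3, (permutesField_iff_of_card_eq_three hd h3 hα).1 h⟩))
          · exact Or.inr (Or.inl ⟨h7, (permutesField_iff_of_card_eq_seven hd h7 hα).1 h⟩)
        · rintro (⟨h, -⟩ | ⟨h7, h⟩ | ⟨h3, h⟩ | ⟨h, -⟩)
          · exact absurd h hF
          · exact (permutesField_iff_of_card_eq_seven hd h7 hα).2 h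
          · exact (permutesField_iff_of_card_eq_three hd h3 hα).2 h
          · exact absurd h h2
    · rintro rfl
      exact ncard_roots_of_card_eq_pow_seven hK'
    · rintro rfl
      exact ncard_roots_of_card_eq_pow_three hK'
    · rintro rfl
      exact ncard_ne_zero_ne_one hK'
  · have : Finite L := Nat.finite_of_card_ne_zero (by rw [hL]; exact pow_ne_zero _ hQ.ne_zero)
    let : Fintype L := Fintype.ofFinite L
    have hL' : Fintype.card L = Q ^ 2 := by rw [← Nat.card_eq_fintype_card, hL]
    constructor
    · intro h
      by_cases hF : Even Q
      · obtain ⟨F, _, _, _, rfl, hd⟩ := FiniteField.exists_algebra_of_natCard_eq_pow hQ two_ne_zero hL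
        exact card_eq_two_of_permutesField hd hF hα h
      · refine absurd h (not_permutesField_of_odd hF (fun h2 => hF ?_) α)
        have := FiniteField.even_card_of_char_two (F := L)
          (CharP.ringChar_of_prime_eq_zero Nat.prime_two (by exact_mod_cast h2))
        rw [hL', ← Nat.even_iff] at this
        exact (Nat.even_pow.1 this).1
    · rintro ⟨rfl, hα1⟩
      exact permutesField_of_card_eq_four hL' hα1
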